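/- Let $\mathbb{K}$ be an algebraically closed field of characteristic zero and let $0 \le \ell \le n$ be integers. Let $\mathrm{Gr}(\ell,\mathbb{P}^n)$ be the Grassmannian of $\ell$-dimensional projective subspaces of $\mathbb{P}^n$, i.e. of $(\ell+1)$-dimensional linear subspaces of $\mathbb{K}^{n+1}$, with the Zariski topology given by the Plücker embedding. Write $\hat L \subset \mathbb{K}^{n+1}$ for the linear subspace corresponding to $L \in \mathrm{Gr}(\ell,\mathbb{P}^n)$, and identify the tangent space of $\mathrm{Gr}(\ell,\mathbb{P}^n)$ at $L$ with $\mathrm{Hom}(\hat L,\mathbb{K}^{n+1}/\hat L)$. For vector spaces $U,W$ let $\mathrm{Seg}(U,W) \subset \mathbb{P}(\mathrm{Hom}(U,W))$ be the set of classes of homomorphisms of rank one. For a subset $X$ of a projective space $\mathbb{P}(E)$, let $\mathrm{Sec}_{k}(X)$ be the Zariski closure in $\mathrm{Gr}(k,\mathbb{P}(E))$ of the set of all $k$-dimensional projective subspaces $M$ with $M=\mathrm{span}(M\cap X)$. Let $\Sigma \subset \mathrm{Gr}(\ell,\mathbb{P}^n)$ be an irreducible closed subvariety of codimension at most $n-1$.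 Then $\Sigma$ is isotropic: with $d := \dim \Sigma$, for every smooth point $L$ of $\Sigma$, the tangent space $T_{\Sigma,L} \subset \mathrm{Hom}(\hat L,\mathbb{K}^{n+1}/\hat L)$ satisfies $$\mathbb{P}(T_{\Sigma,L}) \in \mathrm{Sec}_{d-1}\bigl(\mathrm{Seg}(\hat L,\ \mathbb{K}^{n+1}/\hat L)\bigr).$$ (For $d=0$, which happens only for $\ell=n$, the projective space $\mathbb{P}(T_{\Sigma,L})$ is empty and the condition is void.) -/

import Mathlib

open scoped LinearAlgebra.Projectivization

namespace GrassmannIso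

noncomputable section

/-! ### Zariski topology on a projective space `ℙ(E)`

Polynomials on a finite-dimensional vector space `E` are written as polynomials in the linear
forms on `E`; the variable indexed by a linear form `φ` is evaluated at `x : E` as `φ x`. -/

/-- Polynomials on `E`: polynomial expressions in the linear forms on `E`. -/
abbrev Poly (K E : Type*) [Field K] [AddCommGroup E] [Module K E] : Type _ :=
  MvPolynomial (Module.Dual K E) K

/-- The value of a polynomial on `E` at the vector `x`. -/
def polyEval {K E : Type*} [Field K] [AddCommGroup E] [Module K E] (x : E) (f : Poly K E) : K :=
  MvPolynomial.eval (fun φ : Module.Dual K E => φ x) f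

/-- The differential `⟨df|ₓ, y⟩`, i.e. the derivative of `f` at the point `x` in the
direction `y`.  The derivation used here sends the variable of each linear form `φ` to the
constant `φ y`. -/
def polyDeriv {K E : Type*} [Field K] [AddCommGroup E] [Module K E]
    (x y : E) (f : Poly K E) : K :=
  polyEval x (MvPolynomial.mkDerivation K
    (fun φ : Module.Dual K E => (MvPolynomial.C (φ y) : Poly K E)) f)

theorem polyDeriv_add {K E : Type*} [Field K] [AddCommGroup E] [Module K E]
    (x y z : E) (f : Poly K E) :
    polyDeriv x (y + z) f = polyDeriv x y f + polyDeriv x z f := by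
  have h : MvPolynomial.mkDerivation K
      (fun φ : Module.Dual K E => (MvPolynomial.C (φ (y + z)) : Poly K E)) =
      MvPolynomial.mkDerivation K (fun φ => MvPolynomial.C (φ y)) +
      MvPolynomial.mkDerivation K (fun φ => MvPolynomial.C (φ z)) :=
    MvPolynomial.derivation_ext fun φ => by simp [MvPolynomial.mkDerivation_X]
  rw [polyDeriv, h]
  simp [polyDeriv, polyEval]

theorem polyDeriv_smul {K E : Type*} [Field K] [AddCommGroup E] [Module K E]
    (c : K) (x y : E) (f : Poly K E) :
    polyDeriv x (c • y) f = c * polyDeriv x y f := by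
  have h : MvPolynomial.mkDerivation K
      (fun φ : Module.Dual K E => (MvPolynomial.C (φ (c • y)) : Poly K E)) =
      c • MvPolynomial.mkDerivation K (fun φ => MvPolynomial.C (φ y)) :=
    MvPolynomial.derivation_ext fun φ => by
      simp [MvPolynomial.mkDerivation_X, MvPolynomial.smul_eq_C_mul]
  rw [polyDeriv, h]
  simp [polyDeriv, polyEval, MvPolynomial.smul_eq_C_mul]

/-- For homogeneous `f`, vanishing at a vector only depends on the line through the vector. -/
theorem polyEval_smul {K E : Type*} [Field K] [AddCommGroup E] [Module K E] {f : Poly K E} {m : ℕ}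
    (hf : f.IsHomogeneous m) (c : K) (x : E) : polyEval (c • x) f = c ^ m * polyEval x f := by
  unfold polyEval
  rw [MvPolynomial.eval_eq, MvPolynomial.eval_eq, Finset.mul_sum]
  refine Finset.sum_congr rfl fun d hd => ?_
  have hdeg : ∑ i ∈ d.support, d i = m := by
    have := hf (MvPolynomial.mem_support_iff.mp hd)
    rwa [Finsupp.weight_apply, Finsupp.sum, Finset.sum_congr rfl
      (fun i _ => by simp : ∀ i ∈ d.support, d i • (1 : Module.Dual K E → ℕ) i = d i)] at this
  simp only [map_smul, smul_eq_mul, mul_pow, Finset.prod_mul_distrib, Finset.prod_pow_eq_pow_sum,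
    hdeg]
  ring

/-- The common zero locus in `ℙ(E)` of a family of polynomials (used for homogeneous ones). -/
def projZeroLocus {K E : Type*} [Field K] [AddCommGroup E] [Module K E] (S : Set (Poly K E)) :
    Set (ℙ K E) :=
  {p | ∀ f ∈ S, polyEval p.rep f = 0}

/-- The Zariski topology on `ℙ(E)`: the closed sets are the common zero loci of homogeneous
polynomials. -/
@[reducible]
def projZariski (K E : Type*) [Field K] [AddCommGroup E] [Module K E] :
    TopologicalSpace (ℙ K E) :=
  TopologicalSpace.ofClosed
    {Z | ∃ S : Set (Poly K E), (∀ f ∈ S, ∃ m, f.IsHomogeneous m) ∧ Z = projZeroLocus S}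
    (by
      refine ⟨{1}, ?_, ?_⟩
      · rintro f rfl
        exact ⟨0, MvPolynomial.isHomogeneous_one _ _⟩
      · ext p
        simp [projZeroLocus, polyEval])
    (by
      intro A hA
      refine ⟨{f | (∃ m, f.IsHomogeneous m) ∧ ∃ Z ∈ A, ∀ p ∈ Z, polyEval p.rep f = 0},
        fun f hf => hf.1, ?_⟩
      ext p
      constructor
      · rintro hp f ⟨-, Z, hZ, hf⟩
        exact hf p (hp Z hZ)
      · intro hp Z hZ
        obtain ⟨S, hS, rfl⟩ := hA hZ
        intro f hf
        exact hp f ⟨hS f hf, _, hZ, fun q hq => hq f hf⟩)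
    (by
      rintro _ ⟨S, hS, rfl⟩ _ ⟨T, hT, rfl⟩
      refine ⟨{h | ∃ f ∈ S, ∃ g ∈ T, h = f * g}, ?_, ?_⟩
      · rintro _ ⟨f, hf, g, hg, rfl⟩
        obtain ⟨a, ha⟩ := hS f hf
        obtain ⟨b, hb⟩ := hT g hg
        exact ⟨a + b, ha.mul hb⟩
      · ext p
        constructor
        · rintro (hp | hp) _ ⟨f, hf, g, hg, rfl⟩
          · simpa [polyEval] using Or.inl (hp f hf)
          · simpa [polyEval] using Or.inr (hp g hg)
        · intro hp
          by_contra hcon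
          simp only [Set.mem_union, not_or, projZeroLocus, Set.mem_ofPred_eq, not_forall] at hcon
          obtain ⟨⟨f, hf, hf0⟩, ⟨g, hg, hg0⟩⟩ := hcon
          have := hp _ ⟨f, hf, g, hg, rfl⟩
          simp only [polyEval, map_mul, mul_eq_zero] at this
          exact this.elim hf0 hg0)

/-! ### Grassmannians -/

/-- The Grassmannian `Gr(k, V)` of `k`-dimensional linear subspaces of `V`.  The Grassmannian
`Gr(ℓ, ℙⁿ)` of `ℓ`-dimensional projective subspaces of `ℙⁿ` is `Gr(ℓ + 1, Kⁿ⁺¹)`. -/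
@[ext]
structure Gr (K : Type*) [Field K] (k : ℕ) (V : Type*) [AddCommGroup V] [Module K V] where
  /-- The underlying linear subspace of `V`. -/
  carrier : Submodule K V
  finrank_eq : Module.finrank K carrier = k

section Grassmannian

variable {K : Type*} [Field K] {k : ℕ} {V : Type*} [AddCommGroup V] [Module K V]
  [FiniteDimensional K V]

/-- The line `⋀ᵏ W ⊆ ⋀ᵏ V` attached to a `k`-dimensional subspace `W` of `V`. -/
def plueckerLine (W : Gr K k V) : Submodule K (⋀[K]^k V) :=
  LinearMap.range (exteriorPower.map k W.1.subtype)

theorem finrank_plueckerLine (W : Gr K k V) : Module.finrank K (plueckerLine W) = 1 := by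
  unfold plueckerLine
  rw [LinearMap.finrank_range_of_inj
    (exteriorPower.map_injective_field (Submodule.injective_subtype _)), exteriorPower.finrank_eq, W.2,
    Nat.choose_self]

/-- The Plücker embedding `Gr(k, V) → ℙ(⋀ᵏ V)`. -/
def pluecker (W : Gr K k V) : ℙ K (⋀[K]^k V) :=
  Projectivization.mk'' (plueckerLine W) (finrank_plueckerLine W)

/-- The Zariski topology on the Grassmannian, as a subset of `ℙ(⋀ᵏ V)`. -/
instance : TopologicalSpace (Gr K k V) :=
  TopologicalSpace.induced pluecker (projZariski K (⋀[K]^k V))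

/-- The dimension of a subset of the Grassmannian: its Krull dimension in the Zariski topology. -/
def zdim (Z : Set (Gr K k V)) : WithBot ℕ∞ :=
  topologicalKrullDim Z

/-- `Z` has codimension `c` in the Grassmannian. -/
def HasCodim (Z : Set (Gr K k V)) (c : ℕ) : Prop :=
  zdim Z + (c : WithBot ℕ∞) = zdim (Set.univ : Set (Gr K k V))

/-- The homogeneous polynomials on `⋀ᵏ V` vanishing on (the Plücker image of) `Z`; they generate
the homogeneous ideal of `Z`. -/
def vanishingPolys (Z : Set (Gr K k V)) : Set (Poly K (⋀[K]^k V)) :=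
  {f | (∃ m, f.IsHomogeneous m) ∧ ∀ W ∈ Z, polyEval (pluecker W).rep f = 0}

/-- The homomorphisms `ψ : L → V` such that moving `L` along `ψ` stays in `Z` to first order:
if `b₁, …, bₖ` is a basis of `L`, then every `f` in the ideal of `Z` vanishes to first order
in `ε` at `(b₁ + ε ψ b₁) ∧ ⋯ ∧ (bₖ + ε ψ bₖ)`, that is, the derivative of `f` at `b₁ ∧ ⋯ ∧ bₖ`
vanishes in the direction `∑ᵢ b₁ ∧ ⋯ ∧ ψ bᵢ ∧ ⋯ ∧ bₖ`. -/
def tangentLifts (Z : Set (Gr K k V)) (L : Gr K k V) : Submodule K (L.1 →ₗ[K] V) where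
  carrier := {ψ | ∀ b : Module.Basis (Fin k) K L.1, ∀ f ∈ vanishingPolys Z,
    polyDeriv (exteriorPower.ιMulti K k (fun i => (b i : V)))
      (∑ i, exteriorPower.ιMulti K k (Function.update (fun j => (b j : V)) i (ψ (b i)))) f = 0}
  add_mem' := by
    intro ψ χ hψ hχ b f hf
    have h1 := hψ b f hf
    have h2 := hχ b f hf
    simp only [LinearMap.add_apply, AlternatingMap.map_update_add, Finset.sum_add_distrib]
    rw [polyDeriv_add, h1, h2, add_zero]
  zero_mem' := by
    intro b f hf
    have h := polyDeriv_smul (0 : K) (exteriorPower.ιMulti K k (fun i => (b i : V))) 0 f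
    simpa using h
  smul_mem' := by
    intro c ψ hψ b f hf
    simp only [LinearMap.smul_apply, AlternatingMap.map_update_smul, ← Finset.smul_sum]
    rw [polyDeriv_smul, hψ b f hf, mul_zero]

/-- The tangent space `T_{Z,L} ⊆ Hom(L, V / L)` of `Z` at `L ∈ Z`. -/
def tangentSpace (Z : Set (Gr K k V)) (L : Gr K k V) : Submodule K (L.1 →ₗ[K] V ⧸ L.1) :=
  (tangentLifts Z L).map (LinearMap.compRight K L.1.mkQ)

/-- The regular locus `Reg(Z)` of an irreducible subvariety `Z` of the Grassmannian: the points of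
`Z` at which the tangent space has the same dimension as `Z`. -/
def regularLocus (Z : Set (Gr K k V)) : Set (Gr K k V) :=
  {L | L ∈ Z ∧ (Module.finrank K (tangentSpace Z L) : WithBot ℕ∞) = zdim Z}

end Grassmannian

/-! ### Segre varieties, Grassmann secant varieties, isotropic varieties -/

/-- The Segre variety `Seg(U, W) ⊆ ℙ(Hom(U, W))` of homomorphisms of rank at most one. -/
def segre (K U W : Type*) [Field K] [AddCommGroup U] [Module K U] [AddCommGroup W] [Module K W] :
    Set (ℙ K (U →ₗ[K] W)) :=
  {p | ∀ φ ∈ p.submodule, LinearMap.rank φ ≤ 1}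

/-- The `d`-dimensional linear subspaces of `E` (that is, the `(d - 1)`-dimensional projective
subspaces of `ℙ(E)`) which are spanned by their points in `X ⊆ ℙ(E)`. -/
def spannedBy {K E : Type*} [Field K] [AddCommGroup E] [Module K E] (d : ℕ) (X : Set (ℙ K E)) :
    Set (Gr K d E) :=
  {L | L.1 = ⨆ p ∈ {p : ℙ K E | p ∈ X ∧ p.submodule ≤ L.1}, p.submodule}

/-- The Grassmann secant variety `Sec_{d-1}(X)`: the Zariski closure of the set of all
`(d - 1)`-dimensional projective subspaces that are spanned by their points in `X`. -/
def grassmannSecant {K E : Type*} [Field K] [AddCommGroup E] [Module K E] [FiniteDimensional K E]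
    (d : ℕ) (X : Set (ℙ K E)) : Set (Gr K d E) :=
  closure (spannedBy d X)

/-- The irreducible subvariety `Z` of the Grassmannian is isotropic: for every `L ∈ Reg(Z)`, with
`d = dim T_{Z,L} = dim Z`, one has `ℙ(T_{Z,L}) ∈ Sec_{d-1}(Seg(L, V / L))`. -/
def IsIsotropic {K : Type*} [Field K] {k : ℕ} {V : Type*} [AddCommGroup V] [Module K V]
    [FiniteDimensional K V] (Z : Set (Gr K k V)) : Prop :=
  ∀ L ∈ regularLocus Z,
    (⟨tangentSpace Z L, rfl⟩ :
      Gr K (Module.finrank K (tangentSpace Z L)) (L.1 →ₗ[K] V ⧸ L.1)) ∈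
    grassmannSecant (Module.finrank K (tangentSpace Z L)) (segre K L.1 (V ⧸ L.1))

end

end GrassmannIso

namespace GrassmannIso

/-! ### Polynomials vanishing along curves -/

/-! The result is a dimension count. With u = ℓ + 1 and w = n - ℓ, the Grassmannian has dimension at
least uw (`le_zdim_univ`), so a tangent space at a regular point has codimension at most n - 1 = u +
w - 2 in Hom(L, V/L), and this is the dimension of the Segre variety. It remains to see that every
linear space of such codimension c is a limit of spaces spanned by rank-one maps
(`mem_grassmannSecant_segre`).

For this it suffices to find one such space spanned by Segre points at which it meets the Segre
variety transversally: moving these points along the Segre variety then moves frames of the space in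
every direction to first order, so no nonzero polynomial in the frame coordinates vanishes on all
frames obtained in this way (`mvPolynomial_eq_zero_of_curves`).

The special space (`exists_transverse_frame`) is cut out by the c equations β_j(F α_j) = 0, with the
α_j and the β_j in general position. A rank-one map φ ⊗ y lies in it when each j has φ(α_j) = 0 or
β_j(y) = 0, and transversality holds there if exactly one of the two vanishes for each j, at most u
- 1 times for φ and at most w - 1 times for y. That such points span the space is
`mem_span_transverseRankOne`, by induction on the number of equations not yet split into one of the
two kinds. -/

theorem mvPolynomial_eval_mul_left {K σ : Type*} [Field K] {F : MvPolynomial σ K} {m : ℕ}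
    (hF : F.IsHomogeneous m) (c : K) (x : σ → K) :
    MvPolynomial.eval (fun i => c * x i) F = c ^ m * MvPolynomial.eval x F := by
  rw [MvPolynomial.eval_eq, MvPolynomial.eval_eq, Finset.mul_sum]
  refine Finset.sum_congr rfl fun d hd => ?_
  have hdeg : ∑ i ∈ d.support, d i = m := by
    rw [← hF (MvPolynomial.mem_support_iff.mp hd), Finsupp.weight_apply, Finsupp.sum]
    simp
  simp only [mul_pow, Finset.prod_mul_distrib, Finset.prod_pow_eq_pow_sum, hdeg]
  ring

/-- If through `p`, in every tangent direction, there is a polynomial curve on which `G` vanishes,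
then `G = 0`. -/
theorem mvPolynomial_eq_zero_of_curves {K σ : Type*} [Field K] [Infinite K]
    (G : MvPolynomial σ K) (p : σ → K)
    (H : ∀ y : σ → K, ∃ h : σ → Polynomial K, (∀ i, (h i).eval 0 = y i) ∧
      ∀ t : K, MvPolynomial.eval (fun i => p i + t * (h i).eval t) G = 0) : G = 0 := by
  classical
  set G' : MvPolynomial σ K :=
    MvPolynomial.aeval (fun i => MvPolynomial.C (p i) + MvPolynomial.X i) G with hG'
  have hev : ∀ a : σ → K, MvPolynomial.eval a G' = MvPolynomial.eval (fun i => p i + a i) G := by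
    intro a
    rw [hG', MvPolynomial.aeval_def, MvPolynomial.algebraMap_eq, MvPolynomial.eval_eval₂,
      MvPolynomial.eval, MvPolynomial.coe_eval₂Hom]
    congr 1
    · ext; simp
    · simp
  have hpoly : ∀ (h : σ → Polynomial K) (F : MvPolynomial σ K) (t : K),
      (MvPolynomial.aeval h F).eval t = MvPolynomial.eval (fun i => (h i).eval t) F := by
    intro h F t
    rw [MvPolynomial.aeval_def, ← Polynomial.coe_evalRingHom, MvPolynomial.hom_eval₂,
      MvPolynomial.eval, MvPolynomial.coe_eval₂Hom]
    congr 1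
    ext; simp
  have hzero : ∀ k, MvPolynomial.homogeneousComponent k G' = 0 := by
    intro k
    induction k using Nat.strong_induction_on with
    | _ k ih =>
    by_cases hk : k ∈ Finset.range (G'.totalDegree + 1)
    swap
    · exact MvPolynomial.homogeneousComponent_eq_zero _ _ (by simpa using hk)
    refine MvPolynomial.funext fun y => ?_
    obtain ⟨h, h0, hh⟩ := H y
    have hsum : ∑ j ∈ Finset.range (G'.totalDegree + 1), Polynomial.X ^ j *
        MvPolynomial.aeval h (MvPolynomial.homogeneousComponent j G') = 0 := by
      refine Polynomial.funext fun t => ?_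
      rw [Polynomial.eval_zero, ← hh t, ← hev fun i => t * (h i).eval t, Polynomial.eval_finsetSum]
      conv_rhs => rw [← MvPolynomial.sum_homogeneousComponent G', map_sum]
      refine Finset.sum_congr rfl fun j _ => ?_
      rw [mvPolynomial_eval_mul_left (MvPolynomial.homogeneousComponent_isHomogeneous j G')]
      simp [hpoly]
    -- The coefficient of t^k: components of degree below k vanish by induction, those above k carry
    -- a higher power of t, and degree k contributes its value at h(0) = y.
    have hcoeff := congrArg (fun q : Polynomial K => q.coeff k) hsum
    simp only [Polynomial.finsetSum_coeff, Polynomial.coeff_X_pow_mul', Polynomial.coeff_zero]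
      at hcoeff
    rw [Finset.sum_eq_single_of_mem k hk, if_pos le_rfl, Nat.sub_self,
      Polynomial.coeff_zero_eq_eval_zero, hpoly] at hcoeff
    · simpa [h0] using hcoeff
    · intro j _ hjk
      split_ifs with hle
      · rw [ih j (lt_of_le_of_ne hle hjk)]
        simp
      · rfl
  have hG'0 : G' = 0 := by
    rw [← MvPolynomial.sum_homogeneousComponent G']
    exact Finset.sum_eq_zero fun j _ => hzero j
  refine MvPolynomial.funext fun a => ?_
  have := hev (fun i => a i - p i)
  simpa [hG'0] using this.symm

/-! ### Coordinates on wedge products -/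

section Wedge

variable {K : Type*} [Field K] {k : ℕ} {V : Type*} [AddCommGroup V] [Module K V]

/-- Multilinear expansion makes every linear form on ⋀ᵏ V polynomial in the coefficients of the k
vectors. The sum runs over all index tuples, so no ordering or sign is needed. -/
theorem exists_mvPolynomial_wedge {σ ι : Type*} [Fintype ι] (P : Fin k → ι → MvPolynomial σ K)
    (b : ι → V) (f : Poly K (⋀[K]^k V)) :
    ∃ G : MvPolynomial σ K, ∀ a : σ → K, MvPolynomial.eval a G =
      polyEval (exteriorPower.ιMulti K k fun i => ∑ l, MvPolynomial.eval a (P i l) • b l) f := by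
  classical
  refine ⟨MvPolynomial.aeval (fun φ : Module.Dual K (⋀[K]^k V) => ∑ r : Fin k → ι,
    (∏ i, P i (r i)) * MvPolynomial.C (φ (exteriorPower.ιMulti K k fun i => b (r i)))) f,
    fun a => ?_⟩
  have : ∀ φ : Module.Dual K (⋀[K]^k V),
      φ (exteriorPower.ιMulti K k fun i => ∑ l, MvPolynomial.eval a (P i l) • b l) =
      MvPolynomial.eval a (∑ r : Fin k → ι, (∏ i, P i (r i)) *
        MvPolynomial.C (φ (exteriorPower.ιMulti K k fun i => b (r i)))) := by
    intro φ
    rw [← AlternatingMap.coe_multilinearMap, MultilinearMap.map_sum]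
    simp only [MultilinearMap.map_smul_univ]
    simp
  unfold polyEval
  rw [MvPolynomial.aeval_def, MvPolynomial.algebraMap_eq, MvPolynomial.eval_eval₂]
  simp only [this]
  rw [MvPolynomial.eval, MvPolynomial.coe_eval₂Hom]
  congr 1
  ext; simp

theorem ιMulti_ne_zero {v : Fin k → V} (hv : LinearIndependent K v) :
    exteriorPower.ιMulti K k v ≠ 0 := by
  obtain ⟨g, hg⟩ := (Submodule.span K (Set.range v)).subtype.exists_leftInverse_of_injective
    (Submodule.ker_subtype _)
  intro h
  let b := Module.Basis.span hv
  have h1 := congrArg (exteriorPower.alternatingMapLinearEquiv (b.det.compLinearMap g)) h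
  have h2 : (fun i => g (v i)) = b := by
    funext i
    have := LinearMap.congr_fun hg (b i)
    simpa [b, Module.Basis.span_apply] using this
  rw [exteriorPower.alternatingMapLinearEquiv_apply_ιMulti, map_zero,
    AlternatingMap.compLinearMap_apply, h2, Module.Basis.det_self] at h1
  exact one_ne_zero h1

variable [FiniteDimensional K V]

/-- `rep` is an arbitrary nonzero vector of the Plücker line; homogeneity allows replacing it by the
wedge of any frame. -/
theorem polyEval_pluecker_rep_eq_zero_iff (W : Gr K k V) {v : Fin k → V}
    (hv : LinearIndependent K v) (hW : ∀ i, v i ∈ W.1) {f : Poly K (⋀[K]^k V)} {m : ℕ}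
    (hf : f.IsHomogeneous m) :
    polyEval (pluecker W).rep f = 0 ↔ polyEval (exteriorPower.ιMulti K k v) f = 0 := by
  have hmem : exteriorPower.ιMulti K k v ∈ (pluecker W).submodule := by
    rw [pluecker, Projectivization.submodule_mk'']
    exact ⟨exteriorPower.ιMulti K k fun i => (⟨v i, hW i⟩ : W.1), by
      rw [exteriorPower.map_apply_ιMulti]; rfl⟩
  rw [Projectivization.submodule_eq, Submodule.mem_span_singleton] at hmem
  obtain ⟨c, hc⟩ := hmem
  have hc0 : c ≠ 0 := by
    rintro rfl
    exact ιMulti_ne_zero hv (by rw [← hc, zero_smul])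
  rw [← hc, polyEval_smul hf]
  simp [hc0]

theorem isClosed_iff_polys {A : Set (Gr K k V)} : IsClosed A ↔
    ∃ S : Set (Poly K (⋀[K]^k V)), (∀ f ∈ S, ∃ m, f.IsHomogeneous m) ∧
      A = {W | ∀ f ∈ S, polyEval (pluecker W).rep f = 0} := by
  let _ := projZariski K (⋀[K]^k V)
  have key : ∀ B : Set (ℙ K (⋀[K]^k V)), IsClosed B ↔
      ∃ S : Set (Poly K (⋀[K]^k V)), (∀ f ∈ S, ∃ m, f.IsHomogeneous m) ∧ B = projZeroLocus S := by
    intro B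
    rw [← isOpen_compl_iff]
    change Bᶜᶜ ∈ _ ↔ _
    rw [compl_compl]
    rfl
  rw [isClosed_induced_iff]
  constructor
  · rintro ⟨B, hB, rfl⟩
    obtain ⟨S, hS, rfl⟩ := (key B).1 hB
    exact ⟨S, hS, rfl⟩
  · rintro ⟨S, hS, rfl⟩
    exact ⟨projZeroLocus S, (key _).2 ⟨S, hS, rfl⟩, rfl⟩

theorem mem_closure_of_polys {A : Set (Gr K k V)} {W : Gr K k V}
    (h : ∀ (f : Poly K (⋀[K]^k V)) (m : ℕ), f.IsHomogeneous m →
      (∀ W' ∈ A, polyEval (pluecker W').rep f = 0) → polyEval (pluecker W).rep f = 0) :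
    W ∈ closure A := by
  rw [closure, Set.mem_sInter]
  rintro B ⟨hB, hAB⟩
  obtain ⟨S, hS, rfl⟩ := isClosed_iff_polys.1 hB
  intro f hf
  obtain ⟨m, hm⟩ := hS f hf
  exact h f m hm fun W' hW' => hAB hW' f hf

end Wedge

/-! ### A lower bound for the dimension of the Grassmannian -/

section Dimension

variable {K : Type*} [Field K] {k : ℕ} {V : Type*} [AddCommGroup V] [Module K V]

/-- Homogeneous equations pull back to polynomials on affine space, where a product vanishing
everywhere has a zero factor because K is infinite. -/
theorem isIrreducible_range_of_polys [FiniteDimensional K V] [Infinite K] {σ : Type*} (ρ : (σ → K) → Gr K k V)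
    (hρ : ∀ (f : Poly K (⋀[K]^k V)) (m : ℕ), f.IsHomogeneous m → ∃ G : MvPolynomial σ K,
      ∀ a, polyEval (pluecker (ρ a)).rep f = 0 ↔ MvPolynomial.eval a G = 0) :
    IsIrreducible (Set.range ρ) := by
  refine ⟨Set.range_nonempty ρ, ?_⟩
  rw [isPreirreducible_iff_isClosed_union_isClosed]
  intro A B hA hB hAB
  obtain ⟨S, hS, rfl⟩ := isClosed_iff_polys.1 hA
  obtain ⟨T, hT, rfl⟩ := isClosed_iff_polys.1 hB
  by_contra hcon
  simp only [not_or, Set.not_subset, Set.mem_range, exists_exists_eq_and, Set.mem_ofPred_eq,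
    not_forall] at hcon
  obtain ⟨⟨a, f, hf, hfa⟩, ⟨b, g, hg, hgb⟩⟩ := hcon
  obtain ⟨m, hm⟩ := hS f hf
  obtain ⟨m', hm'⟩ := hT g hg
  obtain ⟨F, hF⟩ := hρ f m hm
  obtain ⟨G, hG⟩ := hρ g m' hm'
  have hFG : F * G = 0 := by
    refine MvPolynomial.funext fun c => ?_
    rw [map_mul, map_zero, mul_eq_zero, ← hF, ← hG]
    exact (hAB ⟨c, rfl⟩).imp (fun h => h f hf) fun h => h g hg
  rcases mul_eq_zero.1 hFG with h | h
  · exact hfa ((hF a).2 (by rw [h, map_zero]))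
  · exact hgb ((hG b).2 (by rw [h, map_zero]))

variable {w : ℕ} (b : Module.Basis (Fin k ⊕ Fin w) K V)

/-- The rows of the matrix `(1 | A)`, with respect to the basis `b`. -/
noncomputable def graphFrame (A : Fin k → Fin w → K) (i : Fin k) : V :=
  ∑ l, (Sum.elim (Pi.single i 1) (A i) l : K) • b l

theorem repr_graphFrame (A : Fin k → Fin w → K) (i : Fin k) (l : Fin k ⊕ Fin w) :
    b.repr (graphFrame b A i) l = Sum.elim (Pi.single i 1) (A i) l := by
  rw [graphFrame, Module.Basis.repr_sum_self]

theorem linearIndependent_graphFrame (A : Fin k → Fin w → K) :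
    LinearIndependent K (graphFrame b A) := by
  refine LinearIndependent.of_comp (LinearMap.pi fun i => b.coord (Sum.inl i)) ?_
  have : (LinearMap.pi fun i => b.coord (Sum.inl i)) ∘ graphFrame b A =
      fun i => Pi.single i (1 : K) := by
    funext i j
    simp [repr_graphFrame]
  rw [this]
  exact Pi.linearIndependent_single_one (Fin k) K

/-- The row space of the matrix `(1 | A)`, with respect to the basis `b`. -/
def graphSubspace (A : Fin k → Fin w → K) : Gr K k V :=
  ⟨Submodule.span K (Set.range (graphFrame b A)), by
    rw [finrank_span_eq_card (linearIndependent_graphFrame b A), Fintype.card_fin]⟩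

theorem polyEval_graphSubspace [FiniteDimensional K V] (A : Fin k → Fin w → K) {f : Poly K (⋀[K]^k V)} {m : ℕ}
    (hf : f.IsHomogeneous m) : polyEval (pluecker (graphSubspace b A)).rep f = 0 ↔
      polyEval (exteriorPower.ιMulti K k (graphFrame b A)) f = 0 :=
  polyEval_pluecker_rep_eq_zero_iff _ (linearIndependent_graphFrame b A)
    (fun i => Submodule.subset_span (Set.mem_range_self i)) hf

/-- The Plücker coordinate that reads off the entry `A i j`. -/
theorem exists_dual_graphFrame (i : Fin k) (j : Fin w) : ∃ φ : Module.Dual K (⋀[K]^k V),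
    ∀ A, φ (exteriorPower.ιMulti K k (graphFrame b A)) = A i j := by
  -- The maximal minor of (1 | A) on the first k columns, with column i replaced by the j-th column
  -- of A.
  refine ⟨exteriorPower.alternatingMapLinearEquiv (Matrix.detRowAlternating.compLinearMap
    (LinearMap.pi (Function.update (fun r => b.coord (Sum.inl r)) i (b.coord (Sum.inr j))))),
    fun A => ?_⟩
  rw [exteriorPower.alternatingMapLinearEquiv_apply_ιMulti, AlternatingMap.compLinearMap_apply]
  have : (fun s => LinearMap.pi (Function.update (fun r => b.coord (Sum.inl r)) i
      (b.coord (Sum.inr j))) (graphFrame b A s)) =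
      (1 : Matrix (Fin k) (Fin k) K).updateCol i fun s => A s j := by
    funext s r
    rcases eq_or_ne r i with rfl | h
    · simp [repr_graphFrame]
    · simp [repr_graphFrame, h, Matrix.one_apply, Pi.single_apply, eq_comm]
  rw [this]
  change Matrix.det _ = _
  rw [← Matrix.cramer_apply, Matrix.cramer_one]
  rfl

/-- The matrix whose first `m` entries, in the order given by `e`, are those of `a`, all other
entries being zero. -/
def truncate (e : Fin k × Fin w ≃ Fin (k * w)) (m : ℕ) {R : Type*} [Zero R]
    (a : Fin k × Fin w → R) (i : Fin k) (j : Fin w) : R :=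
  if (e (i, j) : ℕ) < m then a (i, j) else 0

theorem exists_mvPolynomial_truncate (e : Fin k × Fin w ≃ Fin (k * w)) (m : ℕ)
    (f : Poly K (⋀[K]^k V)) : ∃ G : MvPolynomial (Fin k × Fin w) K, ∀ a,
      MvPolynomial.eval a G =
        polyEval (exteriorPower.ιMulti K k (graphFrame b (truncate e m a))) f := by
  obtain ⟨G, hG⟩ := exists_mvPolynomial_wedge
    (fun i => Sum.elim (Pi.single i 1) (truncate e m (fun p => MvPolynomial.X p) i)) b f
  refine ⟨G, fun a => ?_⟩
  rw [hG]
  congr 2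
  funext i
  refine Finset.sum_congr rfl fun l _ => ?_
  congr 1
  rcases l with l | l
  · simp only [Sum.elim_inl, Pi.single_apply]
    split_ifs <;> simp
  · simp only [Sum.elim_inr, truncate]
    split_ifs <;> simp

/-- Freeing the entries of A one at a time in the chart (1 | A) gives irreducible closed sets that
form a strict chain of length kw. -/
theorem le_zdim_univ [FiniteDimensional K V] [Infinite K]
    (b : Module.Basis (Fin k ⊕ Fin w) K V) :
    ((k * w : ℕ) : WithBot ℕ∞) ≤ zdim (Set.univ : Set (Gr K k V)) := by
  have e : Fin k × Fin w ≃ Fin (k * w) := finProdFinEquiv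
  let ρ (m : ℕ) (a : Fin k × Fin w → K) : Gr K k V := graphSubspace b (truncate e m a)
  have hirr : ∀ m, IsIrreducible (closure (Set.range (ρ m))) := by
    intro m
    refine (isIrreducible_range_of_polys (ρ m) fun f r hf => ?_).closure
    obtain ⟨G, hG⟩ := exists_mvPolynomial_truncate b e m f
    exact ⟨G, fun a => by rw [hG, polyEval_graphSubspace b _ hf]⟩
  have hmono : ∀ m m', m ≤ m' → closure (Set.range (ρ m)) ⊆ closure (Set.range (ρ m')) := by
    intro m m' h
    refine closure_mono ?_
    rintro _ ⟨a, rfl⟩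
    refine ⟨fun p => truncate e m a p.1 p.2, ?_⟩
    simp only [ρ]
    congr 1
    funext i j
    simp only [truncate]
    split_ifs <;> first | rfl | omega
  have hstrict : ∀ m m', m < m' → m' ≤ k * w →
      ¬ closure (Set.range (ρ m')) ⊆ closure (Set.range (ρ m)) := by
    intro m m' h h' hsub
    set p := e.symm ⟨m, by omega⟩ with hp
    have hep : (e (p.1, p.2) : ℕ) = m := by simp [hp]
    -- The coordinate of entry number m vanishes on the m-th set but equals 1 at the truncated
    -- all-ones matrix of the m'-th set.
    obtain ⟨φ, hφ⟩ := exists_dual_graphFrame b p.1 p.2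
    have hX : (MvPolynomial.X φ : Poly K (⋀[K]^k V)).IsHomogeneous 1 :=
      MvPolynomial.isHomogeneous_X _ _
    have hcl : IsClosed {W : Gr K k V | polyEval (pluecker W).rep (MvPolynomial.X φ) = 0} :=
      isClosed_iff_polys.2 ⟨{MvPolynomial.X φ}, by rintro f rfl; exact ⟨1, hX⟩, by simp⟩
    have h1 : closure (Set.range (ρ m)) ⊆ _ := hcl.closure_subset_iff.2 (by
      rintro _ ⟨a, rfl⟩
      change polyEval _ _ = 0
      rw [polyEval_graphSubspace b _ hX]
      simp [polyEval, hφ, truncate, hep])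
    have h2 := h1 (hsub (subset_closure ⟨fun _ => 1, rfl⟩))
    change polyEval _ _ = 0 at h2
    rw [polyEval_graphSubspace b _ hX] at h2
    simp [polyEval, hφ, truncate, hep, h] at h2
  let Φ : Fin (k * w + 1) → TopologicalSpace.IrreducibleCloseds (Gr K k V) := fun m =>
    ⟨closure (Set.range (ρ m)), hirr m, isClosed_closure⟩
  have hΦ : StrictMono Φ := by
    intro m m' h
    rw [← SetLike.coe_ssubset_coe]
    exact ⟨hmono _ _ (Fin.le_def.1 h.le), hstrict _ _ h (by omega)⟩
  rw [zdim, IsHomeomorph.topologicalKrullDim_eq _ (Homeomorph.Set.univ (Gr K k V)).isHomeomorph]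
  refine le_trans ?_ (Order.krullDim_le_of_strictMono Φ hΦ)
  exact Order.le_krullDim_iff.2 ⟨⟨k * w, id, fun i => Fin.castSucc_lt_succ⟩, rfl⟩

end Dimension

/-! ### Linear forms in general position -/

section GeneralPosition

variable {K : Type*} [Field K]

/-- The linear forms `ψ₀, ψ₁, …` on a `u`-dimensional space are in general position: any `u` of
them form a basis of the dual space. -/
structure InGeneralPosition {N : Type*} [AddCommGroup N] [Module K N]
    (ψ : ℕ → Module.Dual K N) (u : ℕ) : Prop where
  separate : ∀ (S : Finset ℕ) (j : ℕ), S.card ≤ u → j ∈ S →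
    ∃ v, ψ j v = 1 ∧ ∀ i ∈ S, i ≠ j → ψ i v = 0
  eq_zero : ∀ S : Finset ℕ, u ≤ S.card → ∀ v, (∀ i ∈ S, ψ i v = 0) → v = 0

/-- Evaluations at distinct points on polynomials of degree less than u: these have fewer than u
roots, and products of linear factors separate points. -/
theorem exists_inGeneralPosition [Infinite K] (N : Type*) [AddCommGroup N] [Module K N]
    [FiniteDimensional K N] :
    ∃ ψ : ℕ → Module.Dual K N, InGeneralPosition ψ (Module.finrank K N) := by
  set u := Module.finrank K N with hu
  let t := Infinite.natEmbedding K
  let e : N ≃ₗ[K] Polynomial.degreeLT K u :=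
    (Module.finBasis K N).equivFun.trans (Polynomial.degreeLTEquiv K u).symm
  refine ⟨fun j => (Polynomial.leval (t j)).comp ((Polynomial.degreeLT K u).subtype.comp e.toLinearMap),
    ⟨fun S j hS hj => ?_, fun S hS v hv => ?_⟩⟩
  · set p : Polynomial K := ∏ i ∈ S.erase j, (Polynomial.X - Polynomial.C (t i)) with hp
    have hpj : p.eval (t j) ≠ 0 := by
      rw [hp, Polynomial.eval_prod, Finset.prod_ne_zero_iff]
      intro i hi
      simpa [sub_eq_zero] using (Finset.ne_of_mem_erase hi).symm
    have hdeg : p ∈ Polynomial.degreeLT K u := by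
      rw [Polynomial.mem_degreeLT, hp, Polynomial.degree_prod]
      simp only [Polynomial.degree_X_sub_C, Finset.sum_const, nsmul_eq_mul, mul_one]
      have := Finset.card_erase_lt_of_mem hj
      exact_mod_cast lt_of_lt_of_le this hS
    refine ⟨(p.eval (t j))⁻¹ • e.symm ⟨p, hdeg⟩, ?_, fun i hi hij => ?_⟩
    · simp [hpj]
    · have : p.eval (t i) = 0 := by
        rw [hp, Polynomial.eval_prod]
        exact Finset.prod_eq_zero (Finset.mem_erase.2 ⟨hij, hi⟩) (by simp)
      simp [this]
  · have h0 : (e v : Polynomial K) = 0 := by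
      refine Polynomial.eq_zero_of_degree_lt_of_eval_index_eq_zero S t.injective.injOn
        (lt_of_lt_of_le (Polynomial.mem_degreeLT.1 (e v).2) (by exact_mod_cast hS)) ?_
      exact hv
    simpa using h0

/-- A subspace over an infinite field is spanned by the complement of finitely many proper
hyperplanes: v = (v + s v₀) - s v₀ with v₀ off all of them and s avoiding finitely many values. -/
theorem le_span_forall_ne_zero [Infinite K] {N : Type*} [AddCommGroup N] [Module K N]
    {ι : Type*} (S : Finset ι) (ψ : ι → Module.Dual K N) (p : Submodule K N)
    (h : ∀ i ∈ S, ∃ v ∈ p, ψ i v ≠ 0) :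
    p ≤ Submodule.span K {v | v ∈ p ∧ ∀ i ∈ S, ψ i v ≠ 0} := by
  classical
  obtain ⟨v₀, hv₀, hne⟩ := Module.Dual.exists_forall_mem_ne_zero_of_forall_exists p
    (fun i : S => ψ i) fun i => h i i.2
  intro v hv
  obtain ⟨s, hs⟩ := Infinite.exists_notMem_finset (S.image fun i => -(ψ i v) / ψ i v₀)
  have hmem : v + s • v₀ ∈ {v | v ∈ p ∧ ∀ i ∈ S, ψ i v ≠ 0} := by
    refine ⟨p.add_mem hv (p.smul_mem s hv₀), fun i hi h0 => hs ?_⟩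
    have hi0 := hne ⟨i, hi⟩
    rw [map_add, map_smul, smul_eq_mul] at h0
    refine Finset.mem_image.2 ⟨i, hi, ?_⟩
    field_simp
    linear_combination -h0
  have := Submodule.sub_mem _ (Submodule.subset_span (R := K) hmem)
    (Submodule.smul_mem _ s (Submodule.subset_span (R := K)
      (s := {v | v ∈ p ∧ ∀ i ∈ S, ψ i v ≠ 0}) ⟨hv₀, fun i hi => hne ⟨i, hi⟩⟩))
  simpa using this

end GeneralPosition

/-! ### Linear sections of the Segre variety -/

section Segre

variable {K : Type*} [Field K] {U W : Type*} [AddCommGroup U] [Module K U] [AddCommGroup W]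
  [Module K W] {u w : ℕ} {α : ℕ → U} {β : ℕ → Module.Dual K W}

theorem exists_smulRight_separate
    (hα : InGeneralPosition (fun j => Module.Dual.eval K U (α j)) u) (hβ : InGeneralPosition β w)
    {P Q R : Finset ℕ} {j : ℕ} (hPj : j ∉ P) (hQj : j ∉ Q) (hRj : j ∉ R)
    (hP : P.card < u) (hQ : Q.card < w) (hcard : P.card + Q.card + R.card + 2 ≤ u + w) :
    ∃ (φ : Module.Dual K U) (y : W), (∀ i ∈ P, φ (α i) = 0) ∧ (∀ i ∈ Q, β i y = 0) ∧
      (∀ i ∈ R, φ (α i) * β i y = 0) ∧ φ (α j) = 1 ∧ β j y = 1 := by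
  -- Of the conditions in R, as many as fit (u - 1 - |P|) are imposed on φ; by `hcard` the rest fit
  -- into the w - 1 - |Q| left for y.
  obtain ⟨A, hAR, hA⟩ := Finset.exists_subset_card_eq
    (min_le_left R.card (u - 1 - P.card))
  have hB := Finset.card_sdiff_add_card_eq_card hAR
  have hPA := Finset.card_union_le P A
  have hQB := Finset.card_union_le Q (R \ A)
  obtain ⟨φ, hφ1, hφ⟩ := hα.separate (insert j (P ∪ A)) j
    ((Finset.card_insert_le _ _).trans (by omega)) (Finset.mem_insert_self _ _)
  obtain ⟨y, hy1, hy⟩ := hβ.separate (insert j (Q ∪ (R \ A))) j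
    ((Finset.card_insert_le _ _).trans (by omega)) (Finset.mem_insert_self _ _)
  have hφ' : ∀ i ∈ P ∪ A, i ≠ j → φ (α i) = 0 := fun i hi => hφ i (Finset.mem_insert_of_mem hi)
  have hy' : ∀ i ∈ Q ∪ (R \ A), i ≠ j → β i y = 0 := fun i hi => hy i (Finset.mem_insert_of_mem hi)
  refine ⟨φ, y, fun i hi => hφ' i (Finset.mem_union_left _ hi) (ne_of_mem_of_not_mem hi hPj),
    fun i hi => hy' i (Finset.mem_union_left _ hi) (ne_of_mem_of_not_mem hi hQj),
    fun i hi => ?_, hφ1, hy1⟩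
  have hij := ne_of_mem_of_not_mem hi hRj
  by_cases hiA : i ∈ A
  · rw [hφ' i (Finset.mem_union_right _ hiA) hij, zero_mul]
  · rw [hy' i (Finset.mem_union_right _ (Finset.mem_sdiff.2 ⟨hi, hiA⟩)) hij, mul_zero]

/-- A sum of the rank-one maps of `exists_smulRight_separate`, one for each index of R. P and Q may
overlap, which the induction below uses. -/
theorem exists_linearMap_interpolate
    (hα : InGeneralPosition (fun j => Module.Dual.eval K U (α j)) u) (hβ : InGeneralPosition β w)
    {P Q R : Finset ℕ} (hPR : Disjoint P R) (hQR : Disjoint Q R)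
    (hP : P.card < u) (hQ : Q.card < w) (hcard : P.card + Q.card + R.card + 1 ≤ u + w)
    (c : ℕ → K) :
    ∃ G : U →ₗ[K] W, (∀ i ∈ P, G (α i) = 0) ∧ (∀ i ∈ Q, ∀ x, β i (G x) = 0) ∧
      ∀ i ∈ R, β i (G (α i)) = c i := by
  have hex : ∀ j, ∃ (φ : Module.Dual K U) (y : W), j ∈ R → (∀ i ∈ P, φ (α i) = 0) ∧
      (∀ i ∈ Q, β i y = 0) ∧ (∀ i ∈ R.erase j, φ (α i) * β i y = 0) ∧ φ (α j) = 1 ∧ β j y = 1 := by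
    intro j
    by_cases hj : j ∈ R
    · have := Finset.card_erase_add_one hj
      obtain ⟨φ, y, h⟩ := exists_smulRight_separate hα hβ (Finset.disjoint_right.1 hPR hj)
        (Finset.disjoint_right.1 hQR hj) (Finset.notMem_erase j R) hP hQ (by omega)
      exact ⟨φ, y, fun _ => h⟩
    · exact ⟨0, 0, fun h => absurd h hj⟩
  choose φ y h using hex
  refine ⟨∑ j ∈ R, c j • (φ j).smulRight (y j), fun i hi => ?_, fun i hi x => ?_, fun i hi => ?_⟩
  · rw [LinearMap.sum_apply]
    refine Finset.sum_eq_zero fun j hj => ?_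
    simp [(h j hj).1 i hi]
  · rw [LinearMap.sum_apply, map_sum]
    refine Finset.sum_eq_zero fun j hj => ?_
    simp [(h j hj).2.1 i hi]
  · rw [LinearMap.sum_apply, map_sum, Finset.sum_eq_single_of_mem i hi]
    · simp [(h i hi).2.2.2]
    · intro j hj hji
      have := (h j hj).2.2.1 i (Finset.mem_erase.2 ⟨hji.symm, hi⟩)
      simp [this]

/-- The homomorphisms `φ ⊗ y` of rank one such that, for each `j ∈ S`, exactly one of `φ (α j)` and
`β j y` vanishes, while at most `u - 1` (resp. `w - 1`) of the former (resp. latter) vanish. -/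
def transverseRankOne (α : ℕ → U) (β : ℕ → Module.Dual K W) (u w : ℕ) (S : Finset ℕ) :
    Set (U →ₗ[K] W) :=
  {F | ∃ (φ : Module.Dual K U) (y : W) (A B : Finset ℕ), A ∪ B = S ∧ Disjoint A B ∧
    A.card < u ∧ B.card < w ∧ (∀ j ∈ A, φ (α j) = 0) ∧ (∀ j ∈ B, φ (α j) ≠ 0) ∧
    (∀ j ∈ B, β j y = 0) ∧ (∀ j ∈ A, β j y ≠ 0) ∧ F = φ.smulRight y}

/-- F lies in p ⊗ q, where p annihilates the α_i for i in P and q is the common kernel of the β_i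
for i in Q. Both factors are spanned by their members with the required nonvanishing. -/
theorem mem_span_transverseRankOne_of_vanish [Infinite K] [FiniteDimensional K U]
    (hα : InGeneralPosition (fun j => Module.Dual.eval K U (α j)) u) (hβ : InGeneralPosition β w)
    {P Q : Finset ℕ} (hPQ : Disjoint P Q) (hP : P.card < u) (hQ : Q.card < w) {F : U →ₗ[K] W}
    (hFP : ∀ i ∈ P, F (α i) = 0) (hFQ : ∀ i ∈ Q, ∀ x, β i (F x) = 0) :
    F ∈ Submodule.span K (transverseRankOne α β u w (P ∪ Q)) := by
  classical
  let p : Submodule K (Module.Dual K U) := (Submodule.span K (α '' P)).dualAnnihilator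
  let q : Submodule K W := ⨅ i ∈ Q, LinearMap.ker (β i)
  have hp : ∀ φ, φ ∈ p ↔ ∀ i ∈ P, φ (α i) = 0 := by
    intro φ
    rw [Submodule.mem_dualAnnihilator]
    refine ⟨fun h i hi => h _ (Submodule.subset_span ⟨i, hi, rfl⟩), fun h x hx => ?_⟩
    have : Submodule.span K (α '' P) ≤ LinearMap.ker φ := Submodule.span_le.2 (by
      rintro _ ⟨i, hi, rfl⟩
      exact h i hi)
    exact this hx
  have hq : ∀ y, y ∈ q ↔ ∀ i ∈ Q, β i y = 0 := by
    intro y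
    simp [q, Submodule.mem_iInf]
  have hspanp := le_span_forall_ne_zero Q (fun j => Module.Dual.eval K U (α j)) p (by
    intro j hj
    obtain ⟨φ, h1, h0⟩ := hα.separate (insert j P) j
      ((Finset.card_insert_le _ _).trans hP) (Finset.mem_insert_self _ _)
    refine ⟨φ, (hp φ).2 fun i hi => h0 i (Finset.mem_insert_of_mem hi) ?_, by simp [h1]⟩
    rintro rfl
    exact Finset.disjoint_left.1 hPQ hi hj)
  have hspanq := le_span_forall_ne_zero P β q (by
    intro j hj
    obtain ⟨y, h1, h0⟩ := hβ.separate (insert j Q) j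
      ((Finset.card_insert_le _ _).trans hQ) (Finset.mem_insert_self _ _)
    refine ⟨y, (hq y).2 fun i hi => h0 i (Finset.mem_insert_of_mem hi) ?_, by simp [h1]⟩
    rintro rfl
    exact Finset.disjoint_left.1 hPQ hj hi)
  have hprod : ∀ φ ∈ p, ∀ y ∈ q,
      φ.smulRight y ∈ Submodule.span K (transverseRankOne α β u w (P ∪ Q)) := by
    intro φ hφ y hy
    have h := Submodule.apply_mem_map₂ (LinearMap.smulRightₗ (R := K) (M := W) (M₂ := U))
      (hspanp hφ) (hspanq hy)
    rw [Submodule.map₂_span_span] at h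
    refine Submodule.span_mono ?_ h
    rintro _ ⟨φ', ⟨hφ', hφ0⟩, y', ⟨hy', hy0⟩, rfl⟩
    exact ⟨φ', y', P, Q, rfl, hPQ, hP, hQ, (hp φ').1 hφ', hφ0, (hq y').1 hy', hy0, rfl⟩
  have hker : Submodule.span K (α '' P) ≤ LinearMap.ker F := Submodule.span_le.2 (by
    rintro _ ⟨i, hi, rfl⟩
    exact hFP i hi)
  let b := Module.finBasis K (U ⧸ Submodule.span K (α '' P))
  let F' := (Submodule.span K (α '' P)).liftQ F hker
  have hF : F = ∑ i, ((b.coord i).comp (Submodule.mkQ _)).smulRight (F' (b i)) := by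
    ext x
    have := congrArg F' (b.sum_repr (Submodule.Quotient.mk x))
    rw [map_sum] at this
    simp only [map_smul] at this
    rw [LinearMap.sum_apply]
    simpa [F'] using this.symm
  rw [hF]
  refine Submodule.sum_mem _ fun i _ => hprod _ ((hp _).2 fun j hj => ?_) _ ((hq _).2 fun j hj => ?_)
  · have : Submodule.Quotient.mk (p := Submodule.span K (α '' P)) (α j) = 0 :=
      (Submodule.Quotient.mk_eq_zero _).2 (Submodule.subset_span ⟨j, hj, rfl⟩)
    simp [this]
  · obtain ⟨x, hx⟩ := Submodule.mkQ_surjective _ (b i)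
    rw [← hx]
    exact hFQ j hj x

/-- Write F = F₁ + F₂ with F₁(α_c) = 0 and β_c ∘ F₂ = 0, both still satisfying the other conditions.
This moves c from R to P for F₁ and to Q for F₂. -/
theorem mem_span_transverseRankOne [Infinite K] [FiniteDimensional K U]
    (hα : InGeneralPosition (fun j => Module.Dual.eval K U (α j)) u) (hβ : InGeneralPosition β w)
    (R : Finset ℕ) : ∀ (P Q : Finset ℕ) (F : U →ₗ[K] W), Disjoint P Q → Disjoint P R →
    Disjoint Q R → P.card < u → Q.card < w → P.card + Q.card + R.card + 2 ≤ u + w →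
    (∀ i ∈ P, F (α i) = 0) → (∀ i ∈ Q, ∀ x, β i (F x) = 0) → (∀ i ∈ R, β i (F (α i)) = 0) →
    F ∈ Submodule.span K (transverseRankOne α β u w (P ∪ Q ∪ R)) := by
  classical
  induction R using Finset.induction_on with
  | empty =>
    intro P Q F hPQ _ _ hP hQ _ hFP hFQ _
    rw [Finset.union_empty]
    exact mem_span_transverseRankOne_of_vanish hα hβ hPQ hP hQ hFP hFQ
  | insert c R hcR ih =>
    intro P Q F hPQ hPR hQR hP hQ hcard hFP hFQ hFR
    have hcP : c ∉ P := fun h => Finset.disjoint_left.1 hPR h (Finset.mem_insert_self _ _)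
    have hcQ : c ∉ Q := fun h => Finset.disjoint_left.1 hQR h (Finset.mem_insert_self _ _)
    have hPR' : Disjoint P R := hPR.mono_right (Finset.subset_insert _ _)
    have hQR' : Disjoint Q R := hQR.mono_right (Finset.subset_insert _ _)
    rw [Finset.card_insert_of_notMem hcR] at hcard
    -- P is full. For i in the remaining set, β_i ∘ F vanishes at u vectors α_j in general position,
    -- hence is zero, and the whole remaining set joins Q.
    by_cases hPu : P.card + 1 = u
    · have hF : ∀ i ∈ insert c R, ∀ x, β i (F x) = 0 := by
        intro i hi x
        have hiP : i ∉ P := Finset.disjoint_right.1 hPR hi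
        have h0 : (β i).comp F = 0 := hα.eq_zero (insert i P)
          (by rw [Finset.card_insert_of_notMem hiP, hPu]) _ (by
            intro j hj
            rcases Finset.mem_insert.1 hj with rfl | hj
            · exact hFR j hi
            · simp [hFP j hj])
        exact LinearMap.congr_fun h0 x
      rw [Finset.union_assoc]
      refine mem_span_transverseRankOne_of_vanish hα hβ
        (Finset.disjoint_union_right.2 ⟨hPQ, hPR⟩) hP ?_ hFP fun i hi => ?_
      · rw [Finset.card_union_of_disjoint hQR, Finset.card_insert_of_notMem hcR]
        omega
      · exact (Finset.mem_union.1 hi).elim (hFQ i) (hF i)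
    by_cases hQw : Q.card + 1 = w
    · have hF : ∀ i ∈ insert c R, F (α i) = 0 := by
        intro i hi
        have hiQ : i ∉ Q := Finset.disjoint_right.1 hQR hi
        refine hβ.eq_zero (insert i Q) (by rw [Finset.card_insert_of_notMem hiQ, hQw]) _ ?_
        intro j hj
        rcases Finset.mem_insert.1 hj with rfl | hj
        · exact hFR j hi
        · exact hFQ j hj _
      rw [Finset.union_right_comm]
      refine mem_span_transverseRankOne_of_vanish hα hβ
        (Finset.disjoint_union_left.2 ⟨hPQ, hQR.symm⟩) ?_ hQ (fun i hi => ?_) hFQ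
      · rw [Finset.card_union_of_disjoint hPR, Finset.card_insert_of_notMem hcR]
        omega
      · exact (Finset.mem_union.1 hi).elim (hFP i) (hF i)
    obtain ⟨a, ha1, ha⟩ := hα.separate (insert c P) c
      ((Finset.card_insert_le _ _).trans hP) (Finset.mem_insert_self _ _)
    have ha1 : a (α c) = 1 := ha1
    have haP : ∀ i ∈ P, a (α i) = 0 := fun i hi =>
      ha i (Finset.mem_insert_of_mem hi) (ne_of_mem_of_not_mem hi hcP)
    have hcPR : Disjoint (insert c P) R := Finset.disjoint_insert_left.2 ⟨hcR, hPR'⟩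
    have hcQR : Disjoint (insert c Q) R := Finset.disjoint_insert_left.2 ⟨hcR, hQR'⟩
    -- The naive splitting with F₂ = a ⊗ F(α_c) breaks the diagonal conditions on R. G restores them
    -- while satisfying both conditions at c, so it can be shifted between the summands.
    obtain ⟨G, hGP, hGQ, hGR⟩ := exists_linearMap_interpolate hα hβ hcPR hcQR
      (by rw [Finset.card_insert_of_notMem hcP]; omega)
      (by rw [Finset.card_insert_of_notMem hcQ]; omega)
      (by rw [Finset.card_insert_of_notMem hcP, Finset.card_insert_of_notMem hcQ]; omega)
      (fun i => β i ((F - a.smulRight (F (α c))) (α i)))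
    have h1 := ih (insert c P) Q (F - a.smulRight (F (α c)) - G)
      (Finset.disjoint_insert_left.2 ⟨hcQ, hPQ⟩) hcPR hQR'
      (by rw [Finset.card_insert_of_notMem hcP]; omega) hQ
      (by rw [Finset.card_insert_of_notMem hcP]; omega)
      (by
        intro i hi
        have := hGP i hi
        rcases Finset.mem_insert.1 hi with rfl | hi
        · simp [this, ha1]
        · simp [this, haP i hi, hFP i hi])
      (by
        intro i hi x
        have := hGQ i (Finset.mem_insert_of_mem hi) x
        simp [this, hFQ i hi])
      (by
        intro i hi
        rw [LinearMap.sub_apply, map_sub, hGR i hi, sub_self])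
    have h2 := ih P (insert c Q) (a.smulRight (F (α c)) + G)
      (Finset.disjoint_insert_right.2 ⟨hcP, hPQ⟩) hPR' hcQR hP
      (by rw [Finset.card_insert_of_notMem hcQ]; omega)
      (by rw [Finset.card_insert_of_notMem hcQ]; omega)
      (by
        intro i hi
        have := hGP i (Finset.mem_insert_of_mem hi)
        simp [this, haP i hi])
      (by
        intro i hi x
        have := hGQ i hi x
        rcases Finset.mem_insert.1 hi with rfl | hi
        · have h := hFR i (Finset.mem_insert_self _ _)
          simp [this, h]
        · simp [this, hFQ i hi])
      (by
        intro i hi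
        have := hFR i (Finset.mem_insert_of_mem hi)
        rw [LinearMap.add_apply, map_add, hGR i hi]
        simp [this])
    have hU1 : insert c P ∪ Q ∪ R = P ∪ Q ∪ insert c R := by
      ext i; simp only [Finset.mem_union, Finset.mem_insert]; tauto
    have hU2 : P ∪ insert c Q ∪ R = P ∪ Q ∪ insert c R := by
      ext i; simp only [Finset.mem_union, Finset.mem_insert]; tauto
    rw [hU1] at h1
    rw [hU2] at h2
    simpa using Submodule.add_mem _ h1 h2

/-- The diagonal values `β j (F (α j))` on the tangent space of the cone over the Segre variety at a
transverse point can be prescribed. -/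
theorem exists_tangent_of_transverseRankOne
    (hα : InGeneralPosition (fun j => Module.Dual.eval K U (α j)) u) (hβ : InGeneralPosition β w)
    {S : Finset ℕ} {φ : Module.Dual K U} {y : W} {A B : Finset ℕ} (hAB : A ∪ B = S)
    (hA : A.card ≤ u) (hB : B.card ≤ w) (hφA : ∀ j ∈ A, φ (α j) = 0)
    (hφB : ∀ j ∈ B, φ (α j) ≠ 0) (hyB : ∀ j ∈ B, β j y = 0) (hyA : ∀ j ∈ A, β j y ≠ 0)
    (c : ℕ → K) : ∃ (φ' : Module.Dual K U) (y' : W),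
      ∀ j ∈ S, φ' (α j) * β j y + φ (α j) * β j y' = c j := by
  classical
  have hex : ∀ (j : ℕ), ∃ φ' : Module.Dual K U, j ∈ A → φ' (α j) = 1 ∧
      ∀ i ∈ A, i ≠ j → φ' (α i) = 0 := by
    intro j
    by_cases hj : j ∈ A
    · obtain ⟨v, hv⟩ := hα.separate A j hA hj
      exact ⟨v, fun _ => hv⟩
    · exact ⟨0, fun h => absurd h hj⟩
  have hey : ∀ (j : ℕ), ∃ y' : W, j ∈ B → β j y' = 1 ∧ ∀ i ∈ B, i ≠ j → β i y' = 0 := by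
    intro j
    by_cases hj : j ∈ B
    · obtain ⟨v, hv⟩ := hβ.separate B j hB hj
      exact ⟨v, fun _ => hv⟩
    · exact ⟨0, fun h => absurd h hj⟩
  choose φ' hφ' using hex
  choose y' hy' using hey
  -- On A only the term with φ' survives, on B only the term with y', so each diagonal value is
  -- divided by its nonzero factor.
  refine ⟨∑ i ∈ A, (c i / β i y) • φ' i, ∑ i ∈ B, (c i / φ (α i)) • y' i, fun j hj => ?_⟩
  rw [← hAB] at hj
  rcases Finset.mem_union.1 hj with hj | hj
  · rw [hφA j hj, zero_mul, add_zero, LinearMap.sum_apply, Finset.sum_eq_single_of_mem j hj]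
    · have := hyA j hj
      simp [(hφ' j hj).1, this]
    · intro i hi hij
      simp [(hφ' i hi).2 j hj hij.symm]
  · rw [hyB j hj, mul_zero, zero_add, map_sum, Finset.sum_eq_single_of_mem j hj]
    · have := hφB j hj
      simp only [map_smul, (hy' j hj).1, smul_eq_mul]
      field_simp
    · intro i hi hij
      simp [(hy' i hi).2 j hj hij.symm]

/-- There is a linear space of any codimension up to the dimension of the Segre variety that is
spanned by points of the Segre variety at which it meets the Segre variety transversally. -/
theorem exists_transverse_frame [Infinite K] [FiniteDimensional K U] [FiniteDimensional K W]
    (hu : 0 < Module.finrank K U) (hw : 0 < Module.finrank K W) {d c : ℕ}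
    (hdc : d + c = Module.finrank K U * Module.finrank K W)
    (hc : c + 2 ≤ Module.finrank K U + Module.finrank K W) :
    ∃ (φ : Fin d → Module.Dual K U) (y : Fin d → W),
      LinearIndependent K (fun i => (φ i).smulRight (y i)) ∧
      ∀ (i : Fin d) (F : U →ₗ[K] W), ∃ (φ' : Module.Dual K U) (y' : W) (a : Fin d → K),
        F = φ'.smulRight (y i) + (φ i).smulRight y' + ∑ j, a j • (φ j).smulRight (y j) := by
  obtain ⟨ψ, hψ⟩ := exists_inGeneralPosition (K := K) (Module.Dual K U)
  obtain ⟨β, hβ⟩ := exists_inGeneralPosition (K := K) W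
  rw [Subspace.dual_finrank_eq] at hψ
  let α : ℕ → U := fun j => (Module.evalEquiv K U).symm (ψ j)
  have hα : InGeneralPosition (fun j => Module.Dual.eval K U (α j)) (Module.finrank K U) := by
    convert hψ using 2 with j
    ext φ
    simp [α]
  let θ : (U →ₗ[K] W) →ₗ[K] (Fin c → K) :=
    LinearMap.pi fun j => (β j).comp (LinearMap.applyₗ (α j))
  have hθ : ∀ F j, θ F j = β j (F (α j)) := fun F j => rfl
  have hsurj : Function.Surjective θ := by
    intro r
    obtain ⟨G, -, -, hG⟩ := exists_linearMap_interpolate hα hβ (Finset.disjoint_empty_left _)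
      (Finset.disjoint_empty_left _) (R := Finset.range c) (by simpa) (by simpa)
      (by simp; omega) (fun j => if h : j < c then r ⟨j, h⟩ else 0)
    refine ⟨G, funext fun j => ?_⟩
    rw [hθ, hG j (by simp)]
    simp
  have hrank : Module.finrank K (LinearMap.ker θ) = d := by
    have := LinearMap.finrank_range_add_finrank_ker θ
    rw [LinearMap.range_eq_top.2 hsurj, finrank_top, Module.finrank_fin_fun,
      Module.finrank_linearMap] at this
    omega
  set Ω := transverseRankOne α β (Module.finrank K U) (Module.finrank K W) (Finset.range c) with hΩ
  have hspan : Submodule.span K Ω = LinearMap.ker θ := by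
    refine le_antisymm (Submodule.span_le.2 ?_) fun F hF => ?_
    · rintro _ ⟨φ, y, A, B, hAB, -, -, -, hA, -, hB, -, rfl⟩
      refine LinearMap.mem_ker.2 (funext fun j => ?_)
      rw [hθ]
      have hj : (j : ℕ) ∈ A ∪ B := by rw [hAB]; simp
      rcases Finset.mem_union.1 hj with hj | hj
      · simp [hA _ hj]
      · simp [hB _ hj]
    · have := mem_span_transverseRankOne hα hβ (Finset.range c) ∅ ∅ F (by simp) (by simp) (by simp)
        (by simpa) (by simpa) (by simp; omega) (by simp) (by simp) (by
          intro i hi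
          exact congrFun (LinearMap.mem_ker.1 hF) ⟨i, Finset.mem_range.1 hi⟩)
      simpa using this
  have hbasis := Submodule.exists_fun_fin_finrank_span_eq K Ω
  rw [hspan, hrank] at hbasis
  obtain ⟨x, hxΩ, hxspan, hxind⟩ := hbasis
  choose φ y A B hAB _ hAu hBw hφA hφB hyB hyA hx using hxΩ
  obtain rfl : x = fun i => (φ i).smulRight (y i) := funext hx
  refine ⟨φ, y, hxind, fun i F => ?_⟩
  -- Transversality: a tangent vector with the same diagonal values as F differs from F by an
  -- element of ker θ, which the frame spans.
  obtain ⟨φ', y', h⟩ := exists_tangent_of_transverseRankOne hα hβ (hAB i) (hAu i).le (hBw i).le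
    (hφA i) (hφB i) (hyB i) (hyA i) fun j => β j (F (α j))
  have hmem : F - (φ'.smulRight (y i) + (φ i).smulRight y') ∈ LinearMap.ker θ := by
    refine LinearMap.mem_ker.2 (funext fun j => ?_)
    rw [hθ]
    have := h j (by simp)
    simp [← this]
  rw [← hxspan] at hmem
  obtain ⟨a, ha⟩ := (Submodule.mem_span_range_iff_exists_fun K).1 hmem
  exact ⟨φ', y', a, by rw [ha]; abel⟩

end Segre

/-! ### Density of the linear spaces spanned by points of the Segre variety -/

section Density

variable {K : Type*} [Field K] {U W : Type*} [AddCommGroup U] [Module K U] [AddCommGroup W]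
  [Module K W]

theorem mk_smulRight_mem_segre (φ : Module.Dual K U) (y : W) (h : φ.smulRight y ≠ 0) :
    Projectivization.mk K (φ.smulRight y) h ∈ segre K U W := by
  intro F hF
  rw [Projectivization.submodule_mk, Submodule.mem_span_singleton] at hF
  obtain ⟨a, rfl⟩ := hF
  have hle : LinearMap.range (a • φ.smulRight y) ≤ Submodule.span K {y} := by
    rintro _ ⟨x, rfl⟩
    exact Submodule.mem_span_singleton.2 ⟨a * φ x, by simp [mul_smul]⟩
  exact (Submodule.rank_mono hle).trans ((rank_span_le _).trans (by simp))

theorem mem_spannedBy_segre_of_span {d : ℕ} {M : Gr K d (U →ₗ[K] W)} {ι : Type*}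
    (φ : ι → Module.Dual K U) (y : ι → W)
    (hM : M.1 = Submodule.span K (Set.range fun i => (φ i).smulRight (y i))) :
    M ∈ spannedBy d (segre K U W) := by
  refine le_antisymm ?_ (iSup₂_le fun p hp => hp.2)
  conv_lhs => rw [hM]
  rw [Submodule.span_le]
  rintro _ ⟨i, rfl⟩
  by_cases h : (φ i).smulRight (y i) = 0
  · simp [h]
  have hmem : (φ i).smulRight (y i) ∈ M.1 := by
    rw [hM]
    exact Submodule.subset_span ⟨i, rfl⟩
  refine (le_iSup₂_of_le (f := fun (p : ℙ K (U →ₗ[K] W))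
    (_ : p ∈ {p : ℙ K (U →ₗ[K] W) | p ∈ segre K U W ∧ p.submodule ≤ M.1}) => p.submodule)
    (Projectivization.mk K _ h) ⟨mk_smulRight_mem_segre _ _ h, ?_⟩ le_rfl) ?_
  · rwa [Projectivization.submodule_mk, Submodule.span_singleton_le_iff_mem]
  · rw [Projectivization.submodule_mk]
    exact Submodule.mem_span_singleton_self _

variable [FiniteDimensional K U] [FiniteDimensional K W]

/-- Linear spaces whose codimension is at most the dimension of the Segre variety lie in its
Grassmann secant variety. -/
theorem mem_grassmannSecant_segre [Infinite K]
    (hu : 0 < Module.finrank K U) (hw : 0 < Module.finrank K W) {d : ℕ}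
    (hd : Module.finrank K U * Module.finrank K W + 2 ≤
      d + Module.finrank K U + Module.finrank K W) (T : Gr K d (U →ₗ[K] W)) :
    T ∈ grassmannSecant d (segre K U W) := by
  have hle : d ≤ Module.finrank K U * Module.finrank K W := by
    have := Submodule.finrank_le T.1
    rwa [T.2, Module.finrank_linearMap] at this
  obtain ⟨φ, y, hind, htrans⟩ := exists_transverse_frame (K := K) hu hw (d := d)
    (c := Module.finrank K U * Module.finrank K W - d) (by omega) (by omega)
  refine mem_closure_of_polys fun f m hf hvan => ?_
  have hindep : ∀ (e : Fin d → U →ₗ[K] W) (φ : Fin d → Module.Dual K U) (y : Fin d → W),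
      LinearIndependent K e →
      (∀ i, e i ∈ Submodule.span K (Set.range fun j => (φ j).smulRight (y j))) →
      polyEval (exteriorPower.ιMulti K d e) f = 0 := by
    intro e φ y he hmem
    have hrank : Module.finrank K (Submodule.span K (Set.range e)) = d := by
      rw [finrank_span_eq_card he, Fintype.card_fin]
    have hspan : Submodule.span K (Set.range e) =
        Submodule.span K (Set.range fun j => (φ j).smulRight (y j)) := by
      refine Submodule.eq_of_le_of_finrank_le (Submodule.span_le.2 ?_) ?_
      · rintro _ ⟨i, rfl⟩
        exact hmem i
      · rw [hrank]
        exact (finrank_range_le_card _).trans_eq (Fintype.card_fin d)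
    exact (polyEval_pluecker_rep_eq_zero_iff ⟨_, hrank⟩ he
      (fun i => Submodule.subset_span (Set.mem_range_self i)) hf).1
      (hvan _ (mem_spannedBy_segre_of_span φ y hspan))
  -- Needed for dependent frames, whose wedge is 0. Vanishing at one independent frame also covers
  -- constant f (m = 0).
  have hzero : polyEval (0 : ⋀[K]^d (U →ₗ[K] W)) f = 0 := by
    have := polyEval_smul hf 0 (exteriorPower.ιMulti K d fun i => (φ i).smulRight (y i))
    rwa [hindep _ φ y hind fun i => Submodule.subset_span (Set.mem_range_self i), mul_zero,
      zero_smul] at this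
  have hall : ∀ (e : Fin d → U →ₗ[K] W) (φ : Fin d → Module.Dual K U) (y : Fin d → W),
      (∀ i, e i ∈ Submodule.span K (Set.range fun j => (φ j).smulRight (y j))) →
      polyEval (exteriorPower.ιMulti K d e) f = 0 := by
    intro e φ y hmem
    by_cases he : LinearIndependent K e
    · exact hindep e φ y he hmem
    · rw [AlternatingMap.map_linearDependent _ _ he, hzero]
  let b := Module.finBasis K (U →ₗ[K] W)
  obtain ⟨G, hG⟩ := exists_mvPolynomial_wedge (fun (i : Fin d) l => MvPolynomial.X (i, l)) b f
  simp only [MvPolynomial.eval_X] at hG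
  have hG0 : G = 0 := by
    refine mvPolynomial_eq_zero_of_curves G
      (fun p => b.repr ((φ p.1).smulRight (y p.1)) p.2) fun Y => ?_
    choose φ' y' a hY using fun i => htrans i (∑ l, Y (i, l) • b l)
    -- The curve of frames is z_i(t) + t ∑ a_ij z_j(t), where z_j(t) = (φ_j + t φ'_j) ⊗ (y_j + t
    -- y'_j). Its t-coefficient is the prescribed direction Y_i; B and C are its coefficients of t²
    -- and t³.
    let τ (i : Fin d) : U →ₗ[K] W := (φ' i).smulRight (y i) + (φ i).smulRight (y' i)
    let B (i : Fin d) : U →ₗ[K] W := (φ' i).smulRight (y' i) + ∑ j, a i j • τ j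
    let C (i : Fin d) : U →ₗ[K] W := ∑ j, a i j • (φ' j).smulRight (y' j)
    refine ⟨fun p => Polynomial.C (Y p) + Polynomial.X * Polynomial.C (b.repr (B p.1) p.2) +
      Polynomial.X ^ 2 * Polynomial.C (b.repr (C p.1) p.2), fun p => by simp, fun t => ?_⟩
    rw [hG]
    let z (j : Fin d) : U →ₗ[K] W := (φ j + t • φ' j).smulRight (y j + t • y' j)
    refine hall _ (fun j => φ j + t • φ' j) (fun j => y j + t • y' j) fun i => ?_
    have hz : ∀ j, z j = (φ j).smulRight (y j) + t • τ j + t ^ 2 • (φ' j).smulRight (y' j) := by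
      intro j
      ext x
      simp only [z, τ, LinearMap.smulRight_apply, LinearMap.add_apply, LinearMap.smul_apply,
        smul_eq_mul]
      module
    have he : ∑ l, (b.repr ((φ i).smulRight (y i)) l + t * (Polynomial.C (Y (i, l)) +
        Polynomial.X * Polynomial.C (b.repr (B i) l) +
        Polynomial.X ^ 2 * Polynomial.C (b.repr (C i) l)).eval t) • b l =
        z i + t • ∑ j, a i j • z j := by
      calc _ = ∑ l, b.repr ((φ i).smulRight (y i)) l • b l + t • (∑ l, Y (i, l) • b l +
            t • ∑ l, b.repr (B i) l • b l + t ^ 2 • ∑ l, b.repr (C i) l • b l) := by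
            simp only [Finset.smul_sum, ← Finset.sum_add_distrib]
            refine Finset.sum_congr rfl fun l _ => ?_
            simp only [Polynomial.eval_add, Polynomial.eval_mul, Polynomial.eval_C,
              Polynomial.eval_X, Polynomial.eval_pow]
            module
        _ = _ := by
            rw [b.sum_repr, b.sum_repr, b.sum_repr, hY i]
            have hsum : ∑ j, a i j • z j = ∑ j, a i j • (φ j).smulRight (y j) +
                t • ∑ j, a i j • τ j + t ^ 2 • C i := by
              simp only [C, Finset.smul_sum, ← Finset.sum_add_distrib]
              refine Finset.sum_congr rfl fun j _ => ?_
              rw [hz j]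
              module
            rw [hsum, hz i]
            simp only [B, τ]
            module
    rw [he]
    have hmem : ∀ j, z j ∈ Submodule.span K
        (Set.range fun j => (φ j + t • φ' j).smulRight (y j + t • y' j)) :=
      fun j => Submodule.subset_span ⟨j, rfl⟩
    exact Submodule.add_mem _ (hmem i) (Submodule.smul_mem _ _
      (Submodule.sum_mem _ fun j _ => Submodule.smul_mem _ _ (hmem j)))
  let v := (Module.finBasisOfFinrankEq K T.1 T.2)
  have hv : LinearIndependent K fun i => (v i : U →ₗ[K] W) :=
    v.linearIndependent.map' T.1.subtype (Submodule.ker_subtype _)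
  rw [polyEval_pluecker_rep_eq_zero_iff T hv (fun i => (v i).2) hf]
  have := hG fun p => b.repr (v p.1 : U →ₗ[K] W) p.2
  simp only [b.sum_repr] at this
  rw [← this, hG0, map_zero]

end Density

end GrassmannIso

/-! ### The codimension count for tangent spaces -/

theorem proposition1p12 {K : Type*} [Field K] [IsAlgClosed K] [CharZero K] (ℓ n : ℕ) (hℓ : ℓ ≤ n)
    (Z : Set (GrassmannIso.Gr K (ℓ + 1) (Fin (n + 1) → K)))
    (hclosed : IsClosed Z) (hirr : IsIrreducible Z)
    (c : ℕ) (hc : GrassmannIso.HasCodim Z c) (hcn : c < n) :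
    GrassmannIso.IsIsotropic Z := by
  intro L hL
  have hinf : Infinite K := CharZero.infinite K
  have hquot : Module.finrank K ((Fin (n + 1) → K) ⧸ L.1) = n - ℓ := by
    have := Submodule.finrank_quotient_add_finrank L.1
    rw [L.2, Module.finrank_fin_fun] at this
    omega
  have hbound : (ℓ + 1) * (n - ℓ) ≤ Module.finrank K (GrassmannIso.tangentSpace Z L) + c := by
    let b := (Pi.basisFun K (Fin (n + 1))).reindex
      ((finSumFinEquiv (m := ℓ + 1) (n := n - ℓ)).trans (finCongr (by omega))).symm
    have h := GrassmannIso.le_zdim_univ b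
    rw [← hc, ← hL.2] at h
    exact_mod_cast h
  rcases Nat.eq_zero_or_pos (n - ℓ) with h0 | hpos
  -- For ℓ = n the Hom space is zero, and its only subspace is spanned by the empty family.
  · have : Subsingleton ((Fin (n + 1) → K) ⧸ L.1) :=
      Module.finrank_zero_iff.1 (hquot.trans h0)
    exact subset_closure (GrassmannIso.mem_spannedBy_segre_of_span (ι := Empty)
      Empty.elim Empty.elim (Subsingleton.elim _ _))
  · refine GrassmannIso.mem_grassmannSecant_segre ?_ ?_ ?_ _
    · rw [L.2]
      omega
    · omega
    · rw [L.2, hquot]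
      omega
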